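/- Let $D$ be a tuple-independent probabilistic database: a finite set of ground tuples $t$, each with a probability $p(t)\in[0,1]$; a random possible world $W\subseteq D$ contains every tuple $t$ independently with probability $p(t)$. Let $q(\vec x)\,\text{:-}\,g_1,\dots,g_m$ be a self-join-free conjunctive query (a conjunction of relational atoms $g_i$, over variables and constants, that refer to pairwise distinct relations; the variables other than the head variables $\vec x$ are existentially quantified). For an assignment $\vec a$ of constants to $\vec x$, the reliability $r(q)(\vec a)$ is the probability that $q(\vec a)$ is true in a random possible world of $D$. Query plans are given by the grammar $P ::= R_i(\vec x_i) \mid \pi_{\vec x}P \mid\ \Join[P_1,\dots,P_k]$ ($k\ge 2$), i.e. atoms, projections with duplicate elimination, and natural joins, with head variables $\mathrm{HVar}(R_i(\vec x_i))$ the set of variables of the atom, $\mathrm{HVar}(\pi_{\vec x}P)=\vec x$, and $\mathrm{HVar}(\Join[P_1,\dots,P_k])=\bigcup_i\mathrm{HVar}(P_i)$. It is required that joins and projections alternate, that $\vec x\subseteq\mathrm{HVar}(P)$ in every $\pi_{\vec x}P$, and that every variable is projected away by at most one projection operator of the plan. $P$ is a plan for $q$ if its atoms are exactly the atoms of $q$,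 each used once, and $\mathrm{HVar}(P)$ is the set of head variables of $q$. The extensional evaluation of $P$ on $D$ computes bottom-up, for every subplan, a relation over its head variables in which every row has a probability (absent rows have probability $0$): an atom returns its matching tuples with their probabilities $p(t)$; a join multiplies the probabilities of the joined rows; a projection gives to a row the value $1-\prod_j(1-p_j)$, where the $p_j$ are the probabilities of the rows with that projection. Let $\mathrm{score}(P)(\vec a)$ be the probability that results for the row $\vec a$ (a single number if $q$ is Boolean). Then for every self-join-free conjunctive query $q$, every plan $P$ for $q$ (whether safe or not), every such database $D$, and every assignment $\vec a$ of constants to the head variables of $q$, $$\mathrm{score}(P)(\vec a)\ \ge\ r(q)(\vec a).$$ In particular, $\mathrm{score}(P)\ge r(q)$ for every plan $P$ of a Boolean query $q$. -/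

import Mathlib

/-!
Tuple-independent probabilistic databases, conjunctive queries, query plans, and the
extensional (independence-assuming) evaluation of plans.

Throughout, `R` is the type of relation names, `ar : R → ℕ` gives their arities, `V` is the type
of variables and `Dom` the type of constants (possibly infinite).
-/

namespace PDB

/-- A term of a query: a variable or a constant. -/
inductive Term (V Dom : Type*) where
  | var (v : V) : Term V Dom
  | const (c : Dom) : Term V Dom

/-- The variables of a term. -/
def Term.vars {V Dom : Type*} : Term V Dom → Finset V
  | .var v => {v}
  | .const _ => ∅

/-- A relational atom (subgoal) `R(u₁, …, uₙ)`; constants and repeated variables are allowed. -/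
structure Atom {R : Type*} (ar : R → ℕ) (V Dom : Type*) where
  rel : R
  args : Fin (ar rel) → Term V Dom

/-- A ground tuple `R(c₁, …, cₙ)`. -/
structure GroundTuple {R : Type*} (ar : R → ℕ) (Dom : Type*) where
  rel : R
  vals : Fin (ar rel) → Dom

/-- A (named) row over the finite set `X` of variables. -/
abbrev Row {V : Type*} (Dom : Type*) (X : Finset V) := {v // v ∈ X} → Dom

/-- Restriction of a row over `Y` to a subset `X` of its variables. -/
def Row.restrict {V Dom : Type*} {X Y : Finset V} (h : X ⊆ Y) (t : Row Dom Y) : Row Dom X :=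
  fun v => t ⟨v.1, h v.2⟩

/-- The value of a term under a row that covers its variables. -/
def Term.eval {V Dom : Type*} : (u : Term V Dom) → Row Dom u.vars → Dom
  | .var v, t => t ⟨v, Finset.mem_singleton_self v⟩
  | .const c, _ => c

/-- The set of variables of an atom. -/
def Atom.vars {R V Dom : Type*} {ar : R → ℕ} [DecidableEq V] (g : Atom ar V Dom) : Finset V :=
  Finset.univ.biUnion fun i => (g.args i).vars

theorem Atom.vars_arg_subset {R V Dom : Type*} {ar : R → ℕ} [DecidableEq V]
    (g : Atom ar V Dom) (i : Fin (ar g.rel)) : (g.args i).vars ⊆ g.vars :=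
  Finset.subset_biUnion_of_mem (fun i => (g.args i).vars) (Finset.mem_univ i)

/-- The ground tuple obtained from an atom by substituting values for its variables. -/
def Atom.ground {R V Dom : Type*} {ar : R → ℕ} [DecidableEq V] (g : Atom ar V Dom)
    (t : Row Dom g.vars) : GroundTuple ar Dom where
  rel := g.rel
  vals := fun i => (g.args i).eval (t.restrict (g.vars_arg_subset i))

theorem Atom.ground_injective {R V Dom : Type*} {ar : R → ℕ} [DecidableEq V]
    (g : Atom ar V Dom) : Function.Injective g.ground := by
  intro s t h
  simp only [Atom.ground, GroundTuple.mk.injEq, heq_eq_eq, true_and] at h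
  funext ⟨v, hv⟩
  obtain ⟨i, -, hi⟩ := Finset.mem_biUnion.1 hv
  have hh := congrFun h i
  have key : ∀ (u : Term V Dom) (hu : u.vars ⊆ g.vars), v ∈ u.vars →
      u.eval (s.restrict hu) = u.eval (t.restrict hu) → s ⟨v, hv⟩ = t ⟨v, hv⟩ := by
    intro u hu hvu he
    cases u with
    | var w =>
      obtain rfl : v = w := by simpa [Term.vars] using hvu
      exact he
    | const c => simp [Term.vars] at hvu
  exact key _ _ hi hh

/-! ### Probabilistic databases and possible worlds -/

/-- A probabilistic database: a finite collection of tuples with their probabilities. -/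
structure Database {R : Type*} (ar : R → ℕ) (Dom : Type*) where
  tuples : Finset (GroundTuple ar Dom)
  prob : GroundTuple ar Dom → ℝ
  prob_nonneg : ∀ f ∈ tuples, 0 ≤ prob f
  prob_le_one : ∀ f ∈ tuples, prob f ≤ 1

open Classical in
/-- The probability of the possible world `W ⊆ D`: every tuple of `D` is included independently
with its own probability. -/
noncomputable def Database.worldProb {R Dom : Type*} {ar : R → ℕ} (D : Database ar Dom)
    (W : Finset (GroundTuple ar Dom)) : ℝ :=
  (∏ f ∈ W, D.prob f) * ∏ f ∈ D.tuples \ W, (1 - D.prob f)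

/-- The probabilities of the possible worlds of a database add up to `1`. -/
theorem Database.sum_worldProb {R Dom : Type*} {ar : R → ℕ} (D : Database ar Dom) :
    ∑ W ∈ D.tuples.powerset, D.worldProb W = 1 := by
  classical
  have h := Finset.prod_add D.prob (fun f => 1 - D.prob f) D.tuples
  simp only [add_sub_cancel, Finset.prod_const_one] at h
  rw [h]
  refine Finset.sum_congr rfl fun W _ => ?_
  unfold Database.worldProb
  congr!

/-! ### Conjunctive queries -/

/-- A conjunctive query `q(x) :- g₁, …, gₘ` with set of head variables `head`. -/
structure Query {R : Type*} (ar : R → ℕ) (V Dom : Type*) [DecidableEq V] where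
  atoms : Multiset (Atom ar V Dom)
  head : Finset V
  head_subset : head ⊆ (atoms.map Atom.vars).sup

/-- The set of all variables of a query. -/
def Query.vars {R V Dom : Type*} {ar : R → ℕ} [DecidableEq V] (q : Query ar V Dom) : Finset V :=
  (q.atoms.map Atom.vars).sup

theorem Query.atom_vars_subset {R V Dom : Type*} {ar : R → ℕ} [DecidableEq V]
    (q : Query ar V Dom) {g : Atom ar V Dom} (hg : g ∈ q.atoms) : g.vars ⊆ q.vars :=
  Multiset.le_sup (Multiset.mem_map_of_mem _ hg)

/-- No two subgoals refer to the same relation. -/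
def Query.SelfJoinFree {R V Dom : Type*} {ar : R → ℕ} [DecidableEq V]
    (q : Query ar V Dom) : Prop :=
  (q.atoms.map Atom.rel).Nodup

/-- `q.Holds W t`: the row `t` over the head variables is an answer of `q` in the (deterministic)
database `W`, i.e. the first-order formula `∃ x₁ … xₖ, g₁ ∧ … ∧ gₘ` is true in `W` at `t`. -/
def Query.Holds {R V Dom : Type*} {ar : R → ℕ} [DecidableEq V] (q : Query ar V Dom)
    (W : Finset (GroundTuple ar Dom)) (t : Row Dom q.head) : Prop :=
  ∃ s : Row Dom q.vars, s.restrict q.head_subset = t ∧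
    ∀ (g : Atom ar V Dom) (hg : g ∈ q.atoms), g.ground (s.restrict (q.atom_vars_subset hg)) ∈ W

open Classical in
/-- The reliability `r(q)` (at the answer `t`): the probability that `t` is an answer of `q` in a
random possible world of `D`. For a Boolean query (`q.head = ∅`) the row `t` is the empty row. -/
noncomputable def Query.reliability {R V Dom : Type*} {ar : R → ℕ} [DecidableEq V]
    (q : Query ar V Dom) (D : Database ar Dom) (t : Row Dom q.head) : ℝ :=
  ∑ W ∈ D.tuples.powerset with q.Holds W t, D.worldProb W

/-! ### Query plans -/

/-- Query plans, indexed by their sets of head variables: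
* a relational atom has its variables as head variables;
* `proj h P` is the projection (with duplicate elimination) of `P` onto a subset `X` of its head
  variables;
* `join hk P` is the natural join of the `k ≥ 2` plans `P 0, …, P (k-1)`; its head variables are
  the union of those of the `P i`. -/
inductive Plan {R : Type*} (ar : R → ℕ) (V Dom : Type*) [DecidableEq V] : Finset V → Type _ where
  | atom (g : Atom ar V Dom) : Plan ar V Dom g.vars
  | proj {X Y : Finset V} (h : X ⊆ Y) (P : Plan ar V Dom Y) : Plan ar V Dom X
  | join {k : ℕ} (hk : 2 ≤ k) {Y : Fin k → Finset V} (P : (i : Fin k) → Plan ar V Dom (Y i)) :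
      Plan ar V Dom (Finset.univ.biUnion Y)

section Plan

variable {R V Dom : Type*} {ar : R → ℕ} [DecidableEq V]

/-- The outermost operator is a projection. -/
def Plan.IsProj {X : Finset V} : Plan ar V Dom X → Prop
  | .atom _ => False
  | .proj _ _ => True
  | .join _ _ => False

/-- The outermost operator is a join. -/
def Plan.IsJoin {X : Finset V} : Plan ar V Dom X → Prop
  | .atom _ => False
  | .proj _ _ => False
  | .join _ _ => True

/-- Joins and projections alternate. -/
def Plan.Alternating : {X : Finset V} → Plan ar V Dom X → Prop
  | _, .atom _ => True
  | _, .proj _ P => ¬ P.IsProj ∧ P.Alternating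
  | _, .join _ P => ∀ i, ¬ (P i).IsJoin ∧ (P i).Alternating

/-- The variables projected away by the projections of a plan, one occurrence for every projection
operator that removes the variable. -/
def Plan.projectedAway : {X : Finset V} → Plan ar V Dom X → Multiset V
  | _, .atom _ => 0
  | X, .proj (Y := Y) _ P => (Y \ X).val + P.projectedAway
  | _, .join _ P => ∑ i, (P i).projectedAway

/-- The atoms mentioned in a plan, with multiplicity. -/
def Plan.atoms : {X : Finset V} → Plan ar V Dom X → Multiset (Atom ar V Dom)
  | _, .atom g => {g}
  | _, .proj _ P => P.atoms
  | _, .join _ P => ∑ i, (P i).atoms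

/-- `P` is a query plan for `q`: joins and projections alternate, every variable is projected away
by at most one operator, and the atoms of `P` are exactly those of `q`. (That the head variables of
`P` are those of `q` is expressed by the type of `P`.) -/
structure Plan.IsPlanFor (q : Query ar V Dom) (P : Plan ar V Dom q.head) : Prop where
  alternating : P.Alternating
  projectedAway_nodup : P.projectedAway.Nodup
  atoms_eq : P.atoms = q.atoms

end Plan

/-! ### Extensional semantics -/

/-- An intermediate relation with a probability attribute: finitely many rows over `X`, each with
a number. Rows that are absent have the value `0`. -/
abbrev ProbRel {V : Type*} (Dom : Type*) (X : Finset V) := Row Dom X →₀ ℝ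

open Classical in
/-- The relation returned by an atom: the matching tuples of the database with their
probabilities. -/
noncomputable def Database.select {R V Dom : Type*} {ar : R → ℕ} [DecidableEq V]
    (D : Database ar Dom) (g : Atom ar V Dom) : ProbRel Dom g.vars :=
  Finsupp.ofSupportFinite (fun t => if g.ground t ∈ D.tuples then D.prob (g.ground t) else 0)
    (by
      refine (D.tuples.finite_toSet.preimage g.ground_injective.injOn).subset ?_
      intro t ht
      by_contra hn
      exact ht (if_neg hn))

open Classical in
/-- The probabilistic project operator: rows with the same projection are treated as independent
events, so that the resulting probability is `1 - ∏ (1 - pᵢ)`. -/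
noncomputable def ProbRel.proj {V Dom : Type*} {X Y : Finset V} (h : X ⊆ Y)
    (r : ProbRel Dom Y) : ProbRel Dom X :=
  Finsupp.onFinset (r.support.image (Row.restrict h))
    (fun t => 1 - ∏ s ∈ r.support with Row.restrict h s = t, (1 - r s))
    (by
      intro t ht
      by_contra hn
      apply ht
      rw [Finset.filter_false_of_mem]
      · simp
      · intro s hs he
        exact hn (Finset.mem_image.2 ⟨s, hs, he⟩))

/-- The probabilistic natural join: the probabilities of the joined rows are multiplied. -/
noncomputable def ProbRel.join {V Dom : Type*} [DecidableEq V] {k : ℕ} {Y : Fin k → Finset V}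
    (r : (i : Fin k) → ProbRel Dom (Y i)) : ProbRel Dom (Finset.univ.biUnion Y) :=
  Finsupp.ofSupportFinite
    (fun t => ∏ i, r i (Row.restrict (Finset.subset_biUnion_of_mem Y (Finset.mem_univ i)) t))
    (by
      have hinj : Function.Injective (fun (t : Row Dom (Finset.univ.biUnion Y)) (i : Fin k) =>
          Row.restrict (Finset.subset_biUnion_of_mem Y (Finset.mem_univ i)) t) := by
        intro s t h
        funext ⟨v, hv⟩
        obtain ⟨i, -, hi⟩ := Finset.mem_biUnion.1 hv
        exact congrFun (congrFun h i) ⟨v, hi⟩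
      have hfin : (Set.univ.pi fun i => ((r i).support : Set (Row Dom (Y i)))).Finite :=
        Set.Finite.pi fun i => (r i).support.finite_toSet
      refine (hfin.preimage hinj.injOn).subset ?_
      intro t ht i _
      have h0 := Finset.prod_ne_zero_iff.1 ht i (Finset.mem_univ i)
      exact Finsupp.mem_support_iff.2 h0)

/-- The extensional evaluation of a plan on a probabilistic database. For a Boolean plan the
result has at most one row, the empty one, and its probability is the score of the plan. -/
noncomputable def Plan.score {R V Dom : Type*} {ar : R → ℕ} [DecidableEq V]
    (D : Database ar Dom) : {X : Finset V} → Plan ar V Dom X → ProbRel Dom X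
  | _, .atom g => D.select g
  | _, .proj h P => (P.score D).proj h
  | _, .join _ P => ProbRel.join fun i => (P i).score D

end PDB

/-! Read the plan on an ordinary database as well: `Plan.Holds W t` says that the row `t` survives
in the world `W`. Two inequalities then chain.

An answer of the query is also an answer of the plan (`Query.Holds.plan_holds`), because a
satisfying assignment restricts to a row of every subplan. Hence the reliability is at most the
probability that the plan returns `t`.

That probability is at most the score (`Plan.subsetProb_holds_le_score`), by induction on the plan.
At an atom the two are equal. The branches of a join use disjoint relations, since there are no
self-joins, so their results really are independent. Under a projection the rows may be correlated,
but their events are increasing in `W`; by Harris' inequality their complements are positively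
correlated, so treating them as independent can only overestimate the probability of the union. -/

namespace PDB

/-! ### Expectations over random subsets -/

open Classical in
/-- The expectation of `f` at a random subset of `T` that contains every `x ∈ T` independently
with probability `p x`. -/
noncomputable def subsetExp {α : Type*} (p : α → ℝ) (T : Finset α) (f : Finset α → ℝ) : ℝ :=
  ∑ W ∈ T.powerset, ((∏ x ∈ W, p x) * ∏ x ∈ T \ W, (1 - p x)) * f W

section Expectation

variable {α : Type*} {p : α → ℝ} {T : Finset α} {f g : Finset α → ℝ}

-- Conditioning on whether `a` is chosen; every induction on `T` below runs on this recursion.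
open Classical in
theorem subsetExp_insert {a : α} (ha : a ∉ T) (f : Finset α → ℝ) :
    subsetExp p (insert a T) f =
      p a * subsetExp p T (fun W => f (insert a W)) + (1 - p a) * subsetExp p T f := by
  unfold subsetExp
  rw [Finset.sum_powerset_insert ha, add_comm, Finset.mul_sum, Finset.mul_sum]
  congr 1 <;> refine Finset.sum_congr rfl fun W hW => ?_
  · have haW : a ∉ W := fun h => ha (Finset.mem_powerset.1 hW h)
    rw [Finset.prod_insert haW, Finset.insert_sdiff_insert, Finset.sdiff_insert_of_notMem ha]
    ring
  · have haW : a ∉ W := fun h => ha (Finset.mem_powerset.1 hW h)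
    rw [Finset.insert_sdiff_of_notMem _ haW, Finset.prod_insert (by simp [ha])]
    ring

theorem subsetExp_empty (f : Finset α → ℝ) : subsetExp p ∅ f = f ∅ := by
  simp [subsetExp]

theorem subsetExp_weight_nonneg [DecidableEq α] (h0 : ∀ x ∈ T, 0 ≤ p x) (h1 : ∀ x ∈ T, p x ≤ 1)
    {W : Finset α} (hW : W ⊆ T) : 0 ≤ (∏ x ∈ W, p x) * ∏ x ∈ T \ W, (1 - p x) :=
  mul_nonneg (Finset.prod_nonneg fun x hx => h0 x (hW hx))
    (Finset.prod_nonneg fun x hx => sub_nonneg.2 (h1 x (Finset.mem_sdiff.1 hx).1))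

theorem subsetExp_mono (h0 : ∀ x ∈ T, 0 ≤ p x) (h1 : ∀ x ∈ T, p x ≤ 1) (h : ∀ W, f W ≤ g W) :
    subsetExp p T f ≤ subsetExp p T g := by
  classical
  refine Finset.sum_le_sum fun W hW => mul_le_mul_of_nonneg_left (h W) ?_
  convert subsetExp_weight_nonneg h0 h1 (Finset.mem_powerset.1 hW)

theorem subsetExp_const (c : ℝ) : subsetExp p T (fun _ => c) = c := by
  classical
  induction T using Finset.induction_on with
  | empty => exact subsetExp_empty _
  | insert a T ha ih => rw [subsetExp_insert ha, ih]; ring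

theorem subsetExp_nonneg (h0 : ∀ x ∈ T, 0 ≤ p x) (h1 : ∀ x ∈ T, p x ≤ 1) (h : ∀ W, 0 ≤ f W) :
    0 ≤ subsetExp p T f := by
  simpa only [subsetExp_const] using subsetExp_mono h0 h1 h

theorem subsetExp_one_sub : subsetExp p T (fun W => 1 - f W) = 1 - subsetExp p T f := by
  have h := subsetExp_const (p := p) (T := T) 1
  simp only [subsetExp] at h ⊢
  simp only [mul_sub, Finset.sum_sub_distrib, h]

/-- `f` depends only on the elements of `A` in its argument. -/
def DependsOnlyOn (f : Finset α → ℝ) (A : Set α) : Prop :=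
  ∀ W W' : Finset α, (∀ x ∈ A, x ∈ W ↔ x ∈ W') → f W = f W'

theorem DependsOnlyOn.insert_of_notMem [DecidableEq α] {A : Set α} (hf : DependsOnlyOn f A)
    {a : α} (ha : a ∉ A) (W : Finset α) : f (insert a W) = f W := by
  refine hf _ _ fun x hx => ?_
  have hxa : x ≠ a := fun h => ha (h ▸ hx)
  simp [hxa]

theorem DependsOnlyOn.comp_insert [DecidableEq α] {A : Set α} (hf : DependsOnlyOn f A) (a : α) :
    DependsOnlyOn (fun W => f (insert a W)) A := by
  refine fun W W' h => hf _ _ fun x hx => ?_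
  simp [h x hx]

/-- Functions of disjoint sets of elements are uncorrelated. -/
theorem subsetExp_mul_of_disjoint {A B : Set α} (hAB : Disjoint A B)
    (hf : DependsOnlyOn f A) (hg : DependsOnlyOn g B) :
    subsetExp p T (fun W => f W * g W) = subsetExp p T f * subsetExp p T g := by
  classical
  induction T using Finset.induction_on generalizing f g with
  | empty => simp only [subsetExp_empty]
  | insert a T ha ih =>
    rw [subsetExp_insert ha, subsetExp_insert ha f, subsetExp_insert ha g, ih hf hg,
      ih (hf.comp_insert a) (hg.comp_insert a)]
    -- At most one of the two functions sees `a`; the other has the same expectation in both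
    -- branches of the conditioning and factors out.
    by_cases hA : a ∈ A
    · simp only [hg.insert_of_notMem (Set.disjoint_left.1 hAB hA)]
      ring
    · simp only [hf.insert_of_notMem hA]
      ring

theorem subsetExp_prod_of_pairwise_disjoint {ι : Type*} (s : Finset ι) {F : ι → Finset α → ℝ}
    {A : ι → Set α} (hA : Pairwise fun i j => Disjoint (A i) (A j))
    (hF : ∀ i, DependsOnlyOn (F i) (A i)) :
    subsetExp p T (fun W => ∏ i ∈ s, F i W) = ∏ i ∈ s, subsetExp p T (F i) := by
  classical
  induction s using Finset.induction_on with
  | empty => simp only [Finset.prod_empty, subsetExp_const]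
  | insert i s hi ih =>
    have hdis : Disjoint (A i) (⋃ j ∈ s, A j) := by
      refine Set.disjoint_iUnion₂_right.2 fun j hj => hA ?_
      rintro rfl
      exact hi hj
    have hdep : DependsOnlyOn (fun W => ∏ j ∈ s, F j W) (⋃ j ∈ s, A j) := fun W W' h =>
      Finset.prod_congr rfl fun j hj => hF j W W' fun x hx => h x (Set.mem_biUnion hj hx)
    simp only [Finset.prod_insert hi]
    rw [subsetExp_mul_of_disjoint hdis (hF i) hdep, ih]

/-- Harris' inequality: decreasing functions are positively correlated. -/
theorem subsetExp_mul_le_of_antitone (h0 : ∀ x ∈ T, 0 ≤ p x) (h1 : ∀ x ∈ T, p x ≤ 1)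
    (hf : Antitone f) (hg : Antitone g) :
    subsetExp p T f * subsetExp p T g ≤ subsetExp p T (fun W => f W * g W) := by
  classical
  induction T using Finset.induction_on generalizing f g with
  | empty => simp only [subsetExp_empty, le_refl]
  | insert a T ha ih =>
    have h0' : ∀ x ∈ T, 0 ≤ p x := fun x hx => h0 x (Finset.mem_insert_of_mem hx)
    have h1' : ∀ x ∈ T, p x ≤ 1 := fun x hx => h1 x (Finset.mem_insert_of_mem hx)
    have ha0 : 0 ≤ p a := h0 a (Finset.mem_insert_self a T)
    have ha1 : 0 ≤ 1 - p a := sub_nonneg.2 (h1 a (Finset.mem_insert_self a T))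
    have hins : ∀ {h : Finset α → ℝ}, Antitone h → Antitone fun W => h (insert a W) :=
      fun hh W W' hW => hh (Finset.insert_subset_insert a hW)
    have hle : ∀ {h : Finset α → ℝ}, Antitone h →
        subsetExp p T (fun W => h (insert a W)) ≤ subsetExp p T h :=
      fun hh => subsetExp_mono h0' h1' fun W => hh (Finset.subset_insert a W)
    rw [subsetExp_insert ha f, subsetExp_insert ha g, subsetExp_insert ha fun W => f W * g W]
    have e1 := mul_le_mul_of_nonneg_left (ih h0' h1' (hins hf) (hins hg)) ha0
    have e2 := mul_le_mul_of_nonneg_left (ih h0' h1' hf hg) ha1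
    -- The covariance of the two conditional expectations given `a` is `p a * (1 - p a)` times the
    -- product of their drops when `a` is added; both drops are nonnegative.
    have e3 := mul_nonneg (mul_nonneg ha0 ha1)
      (mul_nonneg (sub_nonneg.2 (hle hf)) (sub_nonneg.2 (hle hg)))
    linarith

/-- Harris' inequality, one factor at a time; nonnegativity keeps the partial products decreasing.
-/
theorem prod_subsetExp_le_of_antitone (h0 : ∀ x ∈ T, 0 ≤ p x) (h1 : ∀ x ∈ T, p x ≤ 1)
    {ι : Type*} (s : Finset ι) {F : ι → Finset α → ℝ} (hF : ∀ i, Antitone (F i))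
    (hF0 : ∀ i W, 0 ≤ F i W) :
    ∏ i ∈ s, subsetExp p T (F i) ≤ subsetExp p T (fun W => ∏ i ∈ s, F i W) := by
  classical
  induction s using Finset.induction_on with
  | empty => simp only [Finset.prod_empty, subsetExp_const, le_refl]
  | insert i s hi ih =>
    simp only [Finset.prod_insert hi]
    have hanti : Antitone fun W => ∏ j ∈ s, F j W := fun W W' hW =>
      Finset.prod_le_prod (fun j _ => hF0 j W') fun j _ => hF j hW
    exact (mul_le_mul_of_nonneg_left ih (subsetExp_nonneg h0 h1 (hF0 i))).trans
      (subsetExp_mul_le_of_antitone h0 h1 (hF i) hanti)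

/-- The probability that a random subset of `T` has the property `Q`. -/
noncomputable def subsetProb (p : α → ℝ) (T : Finset α) (Q : Finset α → Prop) : ℝ :=
  subsetExp p T (Set.indicator {W | Q W} 1)

theorem subsetProb_nonneg (h0 : ∀ x ∈ T, 0 ≤ p x) (h1 : ∀ x ∈ T, p x ≤ 1)
    (Q : Finset α → Prop) : 0 ≤ subsetProb p T Q :=
  subsetExp_nonneg h0 h1 fun _ => Set.indicator_nonneg (fun _ _ => zero_le_one) _

theorem subsetProb_mono (h0 : ∀ x ∈ T, 0 ≤ p x) (h1 : ∀ x ∈ T, p x ≤ 1)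
    {Q Q' : Finset α → Prop} (h : ∀ W, Q W → Q' W) : subsetProb p T Q ≤ subsetProb p T Q' :=
  subsetExp_mono h0 h1 fun _ =>
    Set.indicator_le_indicator_of_subset (fun W hW => h W hW) (fun _ => zero_le_one) _

theorem subsetProb_mem {a : α} (ha : a ∈ T) :
    subsetProb p T (fun W => a ∈ W) = p a := by
  classical
  have hins : ∀ W : Finset α,
      Set.indicator {W : Finset α | a ∈ W} (1 : Finset α → ℝ) (insert a W) = 1 := fun W =>
    Set.indicator_of_mem (s := {W : Finset α | a ∈ W}) (Finset.mem_insert_self a W) _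
  have hzero : subsetExp p (T.erase a) (Set.indicator {W | a ∈ W} 1) = 0 := by
    refine Finset.sum_eq_zero fun W hW => ?_
    rw [Set.indicator_of_notMem, mul_zero]
    exact fun h => Finset.notMem_erase a T (Finset.mem_powerset.1 hW h)
  rw [subsetProb, ← Finset.insert_erase ha, subsetExp_insert (Finset.notMem_erase a T), hzero]
  simp only [hins, subsetExp_const]
  ring

theorem subsetProb_eq_zero_of_forall_not {Q : Finset α → Prop} (h : ∀ W ⊆ T, ¬ Q W) :
    subsetProb p T Q = 0 := by
  refine Finset.sum_eq_zero fun W hW => ?_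
  rw [Set.indicator_of_notMem (s := {W | Q W}) (h W (Finset.mem_powerset.1 hW)), mul_zero]

/-- Almost surely, none of the properties of probability `0` holds. -/
theorem subsetProb_exists_le (h0 : ∀ x ∈ T, 0 ≤ p x) (h1 : ∀ x ∈ T, p x ≤ 1) {ι : Type*}
    {Q : ι → Finset α → Prop} {S S' : Set ι} (hS : ∀ i ∈ S, i ∉ S' → subsetProb p T (Q i) ≤ 0) :
    subsetProb p T (fun W => ∃ i ∈ S, Q i W) ≤ subsetProb p T (fun W => ∃ i ∈ S ∩ S', Q i W) := by
  classical
  refine Finset.sum_le_sum fun W hW => ?_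
  have hw : 0 ≤ (∏ x ∈ W, p x) * ∏ x ∈ T \ W, (1 - p x) :=
    subsetExp_weight_nonneg h0 h1 (Finset.mem_powerset.1 hW)
  by_cases hQ : ∃ i ∈ S ∩ S', Q i W
  · rw [Set.indicator_of_mem (s := {W | ∃ i ∈ S ∩ S', Q i W}) hQ]
    refine mul_le_mul_of_nonneg_left (Set.indicator_le_self' (fun _ _ => zero_le_one) _) ?_
    convert hw
  by_cases hQ' : ∃ i ∈ S, Q i W
  · obtain ⟨i, hi, hiW⟩ := hQ'
    -- The index set may be infinite, so the argument goes world by world: the weight of `W` is one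
    -- of the nonnegative terms of the probability of `Q i`, hence zero.
    have hz := hS i hi fun hi' => hQ ⟨i, ⟨hi, hi'⟩, hiW⟩
    have hterm : (∏ x ∈ W, p x) * ∏ x ∈ T \ W, (1 - p x) ≤ subsetProb p T (Q i) := by
      have := Finset.single_le_sum (f := fun W => ((∏ x ∈ W, p x) * ∏ x ∈ T \ W, (1 - p x)) *
        Set.indicator {W | Q i W} (1 : Finset α → ℝ) W) (fun W hW => mul_nonneg
          (subsetExp_weight_nonneg h0 h1 (Finset.mem_powerset.1 hW))
          (Set.indicator_nonneg (fun _ _ => zero_le_one) _)) hW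
      rw [Set.indicator_of_mem (s := {W | Q i W}) hiW, Pi.one_apply, mul_one] at this
      refine this.trans (le_of_eq ?_)
      unfold subsetProb subsetExp
      congr!
    have hw0 : (∏ x ∈ W, p x) * ∏ x ∈ T \ W, (1 - p x) = 0 :=
      le_antisymm (hterm.trans hz) hw
    refine le_of_eq ?_
    have key : ∀ x : ℝ, ((∏ x ∈ W, p x) * ∏ x ∈ T \ W, (1 - p x)) * x = 0 := fun x => by
      rw [hw0, zero_mul]
    have e1 := key (Set.indicator {W | ∃ i ∈ S, Q i W} 1 W)
    have e2 := key (Set.indicator {W | ∃ i ∈ S ∩ S', Q i W} 1 W)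
    convert e1.trans e2.symm
  · rw [Set.indicator_of_notMem (s := {W | ∃ i ∈ S, Q i W}) hQ',
      Set.indicator_of_notMem (s := {W | ∃ i ∈ S ∩ S', Q i W}) hQ]

/-- The probability of a finite union of increasing events is at most what it would be if the
events were independent. -/
theorem subsetProb_exists_finset_le (h0 : ∀ x ∈ T, 0 ≤ p x) (h1 : ∀ x ∈ T, p x ≤ 1) {ι : Type*}
    (s : Finset ι) {Q : ι → Finset α → Prop} (hQ : ∀ i, Monotone (Q i)) :
    subsetProb p T (fun W => ∃ i ∈ s, Q i W) ≤ 1 - ∏ i ∈ s, (1 - subsetProb p T (Q i)) := by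
  -- Pass to complements: their indicators are decreasing, and their product is the indicator that
  -- no `Q i` holds.
  have hanti : ∀ i, Antitone fun W => 1 - Set.indicator {W | Q i W} (1 : Finset α → ℝ) W := by
    intro i W W' hW
    refine sub_le_sub_left ?_ _
    by_cases h : Q i W
    · rw [Set.indicator_of_mem (s := {W | Q i W}) h,
        Set.indicator_of_mem (s := {W | Q i W}) (hQ i hW h)]
      rfl
    · rw [Set.indicator_of_notMem (s := {W | Q i W}) h]
      exact Set.indicator_nonneg (fun _ _ => zero_le_one) _
  have hnonneg : ∀ i W, 0 ≤ 1 - Set.indicator {W | Q i W} (1 : Finset α → ℝ) W := fun i W =>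
    sub_nonneg.2 (Set.indicator_le_self' (s := {W | Q i W}) (f := (1 : Finset α → ℝ))
      (fun _ _ => zero_le_one) W)
  have key := prod_subsetExp_le_of_antitone h0 h1 s hanti hnonneg
  have hprod : ∀ W, ∏ i ∈ s, (1 - Set.indicator {W | Q i W} (1 : Finset α → ℝ) W) =
      1 - Set.indicator {W | ∃ i ∈ s, Q i W} (1 : Finset α → ℝ) W := by
    intro W
    by_cases h : ∃ i ∈ s, Q i W
    · obtain ⟨i, hi, hiW⟩ := h
      rw [Set.indicator_of_mem (s := {W | ∃ i ∈ s, Q i W}) ⟨i, hi, hiW⟩]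
      rw [Finset.prod_eq_zero hi] <;> simp [hiW]
    · rw [Set.indicator_of_notMem (s := {W | ∃ i ∈ s, Q i W}) h, sub_zero]
      refine Finset.prod_eq_one fun i hi => ?_
      rw [Set.indicator_of_notMem (s := {W | Q i W}) fun hiW => h ⟨i, hi, hiW⟩, sub_zero]
  simp only [hprod, subsetExp_one_sub] at key
  unfold subsetProb
  linarith

/-- Properties of disjoint sets of elements are independent. -/
theorem subsetProb_forall_of_pairwise_disjoint {ι : Type*} [Fintype ι]
    {Q : ι → Finset α → Prop} {A : ι → Set α} (hA : Pairwise fun i j => Disjoint (A i) (A j))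
    (hQ : ∀ i (W W' : Finset α), (∀ x ∈ A i, x ∈ W ↔ x ∈ W') → (Q i W ↔ Q i W')) :
    subsetProb p T (fun W => ∀ i, Q i W) = ∏ i, subsetProb p T (Q i) := by
  classical
  have hdep : ∀ i, DependsOnlyOn (Set.indicator {W | Q i W} (1 : Finset α → ℝ)) (A i) := by
    intro i W W' h
    simp only [Set.indicator_apply, Set.mem_ofPred_eq, hQ i W W' h, Pi.one_apply]
  unfold subsetProb
  rw [← subsetExp_prod_of_pairwise_disjoint Finset.univ hA hdep]
  congr 1
  funext W
  simp only [Set.indicator_apply, Set.mem_ofPred_eq, Pi.one_apply, Finset.prod_boole,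
    Finset.mem_univ, true_imp_iff]

end Expectation

/-! ### Deterministic semantics of plans -/

section Plan

variable {R V Dom : Type*} {ar : R → ℕ} [DecidableEq V]

/-- `P.Holds W t`: the row `t` is in the result of `P` on the (deterministic) database `W`. -/
def Plan.Holds (W : Finset (GroundTuple ar Dom)) :
    {X : Finset V} → Plan ar V Dom X → Row Dom X → Prop
  | _, .atom g => fun t => g.ground t ∈ W
  | _, .proj h P => fun t => ∃ s, Row.restrict h s = t ∧ P.Holds W s
  | _, .join (Y := Y) _ P => fun t => ∀ i,
      (P i).Holds W (Row.restrict (Finset.subset_biUnion_of_mem Y (Finset.mem_univ i)) t)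

/-- Restricting the hypothesis to the relations of `P` serves two ends: monotonicity in the world,
and, applied in both directions, dependence on the tuples of those relations alone. -/
theorem Plan.Holds.mono_of_rel {W W' : Finset (GroundTuple ar Dom)} {X : Finset V}
    {P : Plan ar V Dom X} (h : ∀ f, f.rel ∈ P.atoms.map Atom.rel → f ∈ W → f ∈ W')
    {t : Row Dom X} (ht : P.Holds W t) : P.Holds W' t := by
  induction P with
  | atom g => exact h (g.ground t) (by simp [Plan.atoms, Atom.ground]) ht
  | proj hXY P ih =>
    obtain ⟨s, rfl, hs⟩ := ht
    exact ⟨s, rfl, ih h hs⟩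
  | join hk P ih =>
    intro i
    refine ih i (fun f hf => h f ?_) (ht i)
    exact Multiset.mem_of_le (Multiset.map_le_map
      (Finset.single_le_sum (f := fun i => (P i).atoms) (fun _ _ => Multiset.zero_le _)
        (Finset.mem_univ i))) hf

theorem Plan.holds_monotone {X : Finset V} (P : Plan ar V Dom X) (t : Row Dom X) :
    Monotone fun W => P.Holds W t :=
  fun _ _ hW => Plan.Holds.mono_of_rel fun _ _ hf => hW hf

/-- A row that satisfies all atoms of a plan restricts to a row of its result. -/
theorem Plan.exists_holds_restrict {W : Finset (GroundTuple ar Dom)} {Z : Finset V}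
    (s : Row Dom Z) {X : Finset V} (P : Plan ar V Dom X)
    (h : ∀ g ∈ P.atoms, ∃ hg : g.vars ⊆ Z, g.ground (s.restrict hg) ∈ W) :
    ∃ hX : X ⊆ Z, P.Holds W (s.restrict hX) := by
  induction P with
  | atom g => exact h g (by simp [Plan.atoms])
  | proj hXY P ih =>
    obtain ⟨hY, hP⟩ := ih h
    -- The values that `s` gives to the projected-away variables are the witness.
    exact ⟨hXY.trans hY, s.restrict hY, rfl, hP⟩
  | join hk P ih =>
    have H := fun i => ih i fun g hg => h g (Multiset.mem_of_le
      (Finset.single_le_sum (f := fun i => (P i).atoms) (fun _ _ => Multiset.zero_le _)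
        (Finset.mem_univ i)) hg)
    exact ⟨Finset.biUnion_subset.2 fun i _ => (H i).1, fun i => (H i).2⟩

/-- The converse can fail: a projection may forget a head variable that an atom outside it retains,
which loses a join condition. -/
theorem Query.Holds.plan_holds {q : Query ar V Dom} {P : Plan ar V Dom q.head}
    (hP : P.atoms = q.atoms) {W : Finset (GroundTuple ar Dom)} {t : Row Dom q.head}
    (h : q.Holds W t) : P.Holds W t := by
  obtain ⟨s, rfl, hs⟩ := h
  exact (P.exists_holds_restrict s fun g hg =>
    ⟨q.atom_vars_subset (hP ▸ hg), hs g (hP ▸ hg)⟩).2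

theorem Query.reliability_eq_subsetProb (q : Query ar V Dom) (D : Database ar Dom)
    (t : Row Dom q.head) :
    q.reliability D t = subsetProb D.prob D.tuples (fun W => q.Holds W t) := by
  classical
  unfold Query.reliability subsetProb subsetExp
  rw [Finset.sum_filter]
  refine Finset.sum_congr rfl fun W _ => ?_
  by_cases h : q.Holds W t
  · rw [if_pos h, Set.indicator_of_mem (s := {W | q.Holds W t}) h, Pi.one_apply, mul_one]
    rfl
  · rw [if_neg h, Set.indicator_of_notMem (s := {W | q.Holds W t}) h, mul_zero]

/-! ### Scores -/

/-- Keeps the factors `1 - score` nonnegative, so that products over projected rows can be compared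
factor by factor. -/
theorem Plan.score_mem_Icc (D : Database ar Dom) {X : Finset V} (P : Plan ar V Dom X)
    (t : Row Dom X) : P.score D t ∈ Set.Icc (0 : ℝ) 1 := by
  classical
  induction P with
  | atom g =>
    change (if g.ground t ∈ D.tuples then D.prob (g.ground t) else 0) ∈ _
    split_ifs with h
    · exact ⟨D.prob_nonneg _ h, D.prob_le_one _ h⟩
    · exact ⟨le_rfl, zero_le_one⟩
  | proj hXY P ih =>
    change 1 - ∏ s ∈ (P.score D).support with Row.restrict hXY s = t, (1 - P.score D s) ∈ _
    refine ⟨sub_nonneg.2 (Finset.prod_le_one ?_ ?_), sub_le_self _ (Finset.prod_nonneg ?_)⟩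
    · exact fun s _ => sub_nonneg.2 (ih s).2
    · exact fun s _ => sub_le_self _ (ih s).1
    · exact fun s _ => sub_nonneg.2 (ih s).2
  | join hk P ih =>
    change ∏ i, (P i).score D _ ∈ _
    exact ⟨Finset.prod_nonneg fun i _ => (ih i _).1,
      Finset.prod_le_one (fun i _ => (ih i _).1) fun i _ => (ih i _).2⟩

theorem Plan.subsetProb_holds_le_score (D : Database ar Dom) {X : Finset V}
    (P : Plan ar V Dom X) (hP : (P.atoms.map Atom.rel).Nodup) (t : Row Dom X) :
    subsetProb D.prob D.tuples (fun W => P.Holds W t) ≤ P.score D t := by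
  classical
  have h0 := D.prob_nonneg
  have h1 := D.prob_le_one
  induction P with
  | atom g =>
    change _ ≤ if g.ground t ∈ D.tuples then D.prob (g.ground t) else 0
    split_ifs with h
    · exact (subsetProb_mem h).le
    · exact (subsetProb_eq_zero_of_forall_not fun W hW hg => h (hW hg)).le
  | proj hXY P ih =>
    change _ ≤ 1 - ∏ s ∈ (P.score D).support with Row.restrict hXY s = t, (1 - P.score D s)
    -- Over an infinite domain infinitely many rows `s` may project to `t`. Those outside the
    -- support have score `0`, hence probability `0` by induction, and can be dropped.
    have hzero : ∀ s ∈ {s | Row.restrict hXY s = t}, s ∉ ((P.score D).support : Set _) →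
        subsetProb D.prob D.tuples (fun W => P.Holds W s) ≤ 0 := fun s _ hs =>
      (ih hP s).trans_eq (Finsupp.notMem_support_iff.1 hs)
    calc subsetProb D.prob D.tuples (fun W => ∃ s ∈ {s | Row.restrict hXY s = t}, P.Holds W s)
        ≤ _ := subsetProb_exists_le h0 h1 hzero
      _ ≤ subsetProb D.prob D.tuples (fun W =>
            ∃ s ∈ (P.score D).support.filter (Row.restrict hXY · = t), P.Holds W s) :=
          subsetProb_mono h0 h1 fun W ⟨s, hs, hW⟩ => ⟨s, Finset.mem_filter.2 hs.symm, hW⟩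
      _ ≤ _ := subsetProb_exists_finset_le h0 h1 _ fun s => P.holds_monotone s
      -- On `[0, 1]`, `1 - ∏ (1 - x)` increases with every `x`, so scores may replace probabilities.
      _ ≤ _ := sub_le_sub_left (Finset.prod_le_prod
          (fun s _ => sub_nonneg.2 (P.score_mem_Icc D s).2)
          fun s _ => sub_le_sub_left (ih hP s) 1) 1
  | join hk P ih =>
    have hle : ∀ i, (P i).atoms ≤ ∑ i, (P i).atoms := fun i =>
      Finset.single_le_sum (f := fun i => (P i).atoms) (fun _ _ => Multiset.zero_le _)
        (Finset.mem_univ i)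
    -- Two branches sharing a relation would repeat its name in the list of relations of the join,
    -- contrary to `hP`.
    have hdis : Pairwise fun i j => Disjoint
        {f : GroundTuple ar Dom | f.rel ∈ (P i).atoms.map Atom.rel}
        {f : GroundTuple ar Dom | f.rel ∈ (P j).atoms.map Atom.rel} := by
      intro i j hij
      have hij' : (P i).atoms + (P j).atoms ≤ ∑ i, (P i).atoms := by
        rw [← Finset.sum_pair (f := fun i => (P i).atoms) hij]
        exact Finset.sum_le_sum_of_subset (Finset.subset_univ _)
      have hnd := Multiset.nodup_of_le (Multiset.map_le_map (f := Atom.rel) hij') hP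
      rw [Multiset.map_add, Multiset.nodup_add] at hnd
      exact Set.disjoint_left.2 fun f hi hj => Multiset.disjoint_left.1 hnd.2.2 hi hj
    refine (subsetProb_forall_of_pairwise_disjoint hdis fun i W W' h => ?_).trans_le ?_
    · exact ⟨Plan.Holds.mono_of_rel fun f hf => (h f hf).1,
        Plan.Holds.mono_of_rel fun f hf => (h f hf).2⟩
    · exact Finset.prod_le_prod (fun i _ => subsetProb_nonneg h0 h1 _) fun i _ =>
        ih i (Multiset.nodup_of_le (Multiset.map_le_map (hle i)) hP) _

end Plan

end PDB

theorem mainTheorem4 {R V Dom : Type*} {ar : R → ℕ} [DecidableEq V]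
    (q : PDB.Query ar V Dom) (hq : q.SelfJoinFree)
    (P : PDB.Plan ar V Dom q.head) (hP : P.IsPlanFor q)
    (D : PDB.Database ar Dom) (t : PDB.Row Dom q.head) :
    q.reliability D t ≤ P.score D t := by
  rw [q.reliability_eq_subsetProb D t]
  refine (PDB.subsetProb_mono D.prob_nonneg D.prob_le_one fun W h =>
    h.plan_holds hP.atoms_eq).trans (P.subsetProb_holds_le_score D ?_ t)
  rw [hP.atoms_eq]
  exact hq
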